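/- Let $M$ be a real analytic manifold with a real analytic, time-oriented Lorentzian metric $g$ of signature $(+,-,\dots,-)$, and let $V^-\subset T^*M$ be the bundle of closed past light cones, i.e. the set of covectors $\xi$ with $g^{-1}(\xi,\xi)\ge 0$ that are past directed or zero. Let $\mathcal H$ be a Hilbert space with a dense subspace $D$, and let $\Phi: C_0^\infty(M)\to \mathrm{End}(D)$ be a quantum field: a linear map such that $f\mapsto \Phi(f)v\in\mathcal H$ is continuous for every $v\in D$ and $\Phi(f)$ is symmetric on $D$ for real-valued $f$. Let $\iota: M\to\mathbb R^{d'}$ be a proper real analytic embedding, and let $\mathcal S(M)=\iota^*\mathcal S(\mathbb R^{d'})$ be the space of restrictions of Schwartz functions with the quotient topology. Suppose that $\Phi$ extends as an operator-valued distribution to $\mathcal S(M)$, that is, to a linear map $\Phi:\mathcal S(M)\to\mathrm{End}(D)$ such that $f\mapsto\Phi(f)v\in\mathcal H$ is continuous for every $v\in D$. Definitions. For $h>0$ and $f\in\mathcal S(\mathbb R^{n})$ let $$(T_hf)(x,\xi)=2^{-n/2}(\pi h)^{-3n/4}\int_{\mathbb R^{n}} e^{-(x-y)^2/(2h)}e^{\frac{\mathrm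 i}{h}(x-y)\cdot\xi}f(y)\,\mathrm dy .$$ A family $(f_h)$ in $\mathcal S(\mathbb R^n)$ is in $\mathcal S_h(\mathbb R^n)$ if for every Schwartz seminorm $p$ there is $N$ with $p(f_h)=O(h^{-N})$ as $h\searrow0$. It is uniformly microsupported in $K\subseteq\mathbb R^n\times\mathbb R^n$ if for every $\epsilon>0$ there is $\delta>0$ such that for every $N$, as $h\searrow 0$, $(1+|x|^2+|\xi|^2)^N|(T_hf_h)(x,\xi)|=O(e^{-\delta/h})$ uniformly for $(x,\xi)$ with $\mathrm{dist}((x,\xi),K)>\epsilon$. Let $\mathcal S_{h,O}(\mathbb R^n)$ be the set of families in $\mathcal S_h(\mathbb R^n)$ that are uniformly microsupported in $\mathbb R^n\times\{0\}$. Put $\mathcal S_h(M)=\iota^*\mathcal S_h(\mathbb R^{d'})$, $\mathcal S_{h,O}(M)=\iota^*\mathcal S_{h,O}(\mathbb R^{d'})$ and $\mathcal S_a(M)=\iota^*\mathcal F(C_0^\infty(\mathbb R^{d'}))$, where $\mathcal F$ is the Fourier transform. A family $(f_h)\in\mathcal S_h(M)$ is uniformly microsupported in a compact set $K\subset T^*M$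 if $f_h=\iota^*F_h$ for a family $(F_h)\in\mathcal S_h(\mathbb R^{d'})$ that is uniformly microsupported in a compact set $L\subset\mathbb R^{d'}\times\mathbb R^{d'}$ such that $(x,(\mathrm d\iota(x))^T\eta)\in K$ whenever $x\in M$ and $(\iota(x),\eta)\in L$. A vector $\Omega\in D$ is tempered analytic if for every compact $K\subset T^*M$ with $K\cap V^-=\emptyset$, every $(f_h)\in\mathcal S_h(M)$ that is uniformly microsupported in $K$, every $n\ge 0$ and all $(q_{1,h}),\dots,(q_{n,h})\in\mathcal S_{h,O}(M)$ there is $\delta>0$ with $$\|\Phi(f_h)\Phi(q_{1,h})\cdots\Phi(q_{n,h})\Omega\|=O(e^{-\delta/h})\quad\text{as }h\searrow0 .$$ Theorem. Let $\Omega\in D$ be tempered analytic. Then for all $m\ge 0$ and $g_1,\dots,g_m\in\mathcal S_a(M)$ the vector $\Phi(g_1)\cdots\Phi(g_m)\Omega$ is tempered analytic. Moreover, if $\Omega$ is cyclic, i.e. if $\mathcal A\Omega$ is dense in $\mathcal H$ for the algebra $\mathcal A$ generated by the operators $\Phi(f)$, $f\in C_0^\infty(M)$, then the set of tempered analytic vectors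 is dense in $\mathcal H$. -/

import Mathlib

open Filter Topology Asymptotics
open scoped Manifold ContDiff SchwartzMap FourierTransform InnerProductSpace

noncomputable section

namespace TemperedQFT

/-- The Euclidean space `ℝⁿ`. -/
abbrev Euc (n : ℕ) : Type := EuclideanSpace ℝ (Fin n)

/-! ### Families of Schwartz functions and their phase-space localisation

Families `(F_h)` are functions `F` of a real parameter `h`; only their behaviour as `h ↘ 0`
enters. -/

/-- The semi-classical FBI transform
`(T_h f)(x, ξ) = 2^{-n/2} (π h)^{-3n/4} ∫ e^{-(x-y)²/(2h)} e^{(i/h) (x-y)·ξ} f(y) dy`. -/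
def fbi {n : ℕ} (h : ℝ) (f : 𝓢(Euc n, ℂ)) (x ξ : Euc n) : ℂ :=
  (((2 : ℝ) ^ (-(n : ℝ) / 2) * (Real.pi * h) ^ (-(3 * (n : ℝ)) / 4) : ℝ) : ℂ) *
    ∫ y : Euc n, ((Real.exp (-(‖x - y‖ ^ 2 / (2 * h))) : ℝ) : ℂ) *
      Complex.exp (Complex.I * ((⟪x - y, ξ⟫_ℝ / h : ℝ) : ℂ)) * f y

/-- `𝒮_h(ℝⁿ)`: every Schwartz seminorm of `F_h` is `O(h^{-N})` as `h ↘ 0`, for some `N`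
depending on the seminorm. -/
def PolynomiallyBounded {n : ℕ} (F : ℝ → 𝓢(Euc n, ℂ)) : Prop :=
  ∀ k l : ℕ, ∃ N : ℕ,
    (fun h => SchwartzMap.seminorm ℝ k l (F h)) =O[𝓝[>] (0 : ℝ)] fun h => (h ^ N)⁻¹

/-- `(F_h)` is microlocally uniformly exponentially small in `U ⊆ ℝⁿ × ℝⁿ`. -/
def MicrolocallyExpSmallOn {n : ℕ} (F : ℝ → 𝓢(Euc n, ℂ)) (U : Set (Euc n × Euc n)) : Prop :=
  ∃ δ > 0, ∀ N : ℕ, ∃ C : ℝ, ∀ᶠ h in 𝓝[>] (0 : ℝ), ∀ p ∈ U,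
    (1 + ‖p.1‖ ^ 2 + ‖p.2‖ ^ 2) ^ N * ‖fbi h (F h) p.1 p.2‖ ≤ C * Real.exp (-δ / h)

/-- `(F_h)` is uniformly microsupported in `K ⊆ ℝⁿ × ℝⁿ`: it is microlocally uniformly
exponentially small at distance `> ε` from `K`, for every `ε > 0` (the distance to the empty set
is `∞`). -/
def UniformlyMicrosupportedIn {n : ℕ} (F : ℝ → 𝓢(Euc n, ℂ)) (K : Set (Euc n × Euc n)) : Prop :=
  ∀ ε > 0, MicrolocallyExpSmallOn F {p | ENNReal.ofReal ε < Metric.infEDist p K}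

/-- `𝒮_{h,O}(ℝⁿ)`: polynomially bounded families that are uniformly microsupported in the zero
section `ℝⁿ × {0}`. -/
def ZeroEnergy {n : ℕ} (F : ℝ → 𝓢(Euc n, ℂ)) : Prop :=
  PolynomiallyBounded F ∧ UniformlyMicrosupportedIn F {p | p.2 = 0}

/-! ### Spacetimes -/

section Manifold

variable (d : ℕ) (M : Type*) [TopologicalSpace M] [ChartedSpace (Euc d) M]
  [IsManifold (𝓡 d) ω M]

/-- A real analytic Lorentzian metric of signature `(+, -, …, -)` on the real analytic manifold
`M`, with a time orientation given by a continuous timelike vector field (pointing to the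
future). -/
structure Spacetime where
  metric : ∀ x : M, TangentSpace (𝓡 d) x →L[ℝ] TangentSpace (𝓡 d) x →L[ℝ] ℝ
  symm : ∀ (x : M) (v w : TangentSpace (𝓡 d) x), metric x v w = metric x w v
  analytic : ContMDiff (𝓡 d) ((𝓡 d).prod 𝓘(ℝ, Euc d →L[ℝ] Euc d →L[ℝ] ℝ)) ω
    (fun x => Bundle.TotalSpace.mk' (Euc d →L[ℝ] Euc d →L[ℝ] ℝ) x (metric x))
  future : ∀ x : M, TangentSpace (𝓡 d) x
  future_continuous : Continuous fun x => (⟨x, future x⟩ : TangentBundle (𝓡 d) M)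
  future_timelike : ∀ x, 0 < metric x (future x) (future x)
  lorentzian : ∀ (x : M) (w : TangentSpace (𝓡 d) x),
    metric x (future x) w = 0 → w ≠ 0 → metric x w w < 0

/-- The cotangent bundle `T*M`, with its vector bundle topology. -/
abbrev Cotangent : Type _ :=
  Bundle.TotalSpace (Euc d →L[ℝ] ℝ) (fun x : M => TangentSpace (𝓡 d) x →L[ℝ] ℝ)

/-- The test function space `C₀^∞(M)` of complex-valued smooth functions of compact support. -/
def testFunctions : Submodule ℂ (M → ℂ) where
  carrier := {f | ContMDiff (𝓡 d) 𝓘(ℝ, ℂ) ∞ f ∧ HasCompactSupport f}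
  zero_mem' := ⟨contMDiff_const, HasCompactSupport.zero⟩
  add_mem' := fun hf hg => ⟨hf.1.add hg.1, hf.2.add hg.2⟩
  smul_mem' := fun c _ hf =>
    ⟨(contDiff_const_smul (𝕜 := ℝ) (F := ℂ) c).comp_contMDiff hf.1, hf.2.smul_left (f := fun _ => c)⟩

variable {d M}

/-- The closed past light cones: the covectors `ξ` with `g⁻¹(ξ, ξ) ≥ 0` that are past directed
or zero. Here `ξ = g(v, ·)`, so that `g⁻¹(ξ, ξ) = g(v, v)`. -/
def Spacetime.pastCone (S : Spacetime d M) : Set (Cotangent d M) :=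
  {p | ∃ v : TangentSpace (𝓡 d) p.proj,
    p.snd = S.metric p.proj v ∧ 0 ≤ S.metric p.proj v v ∧ p.snd (S.future p.proj) ≤ 0}

/-- Convergence of a sequence in `C₀^∞(M)`: the supports lie in a common compact set, and in the
charts all derivatives converge uniformly on compact sets. -/
def TestConverges (f : ℕ → testFunctions d M) (f₀ : testFunctions d M) : Prop :=
  (∃ K : Set M, IsCompact K ∧ ∀ n, tsupport (f n : M → ℂ) ⊆ K) ∧
  ∀ (x : M) (k : ℕ) (C : Set (Euc d)), IsCompact C → C ⊆ (chartAt (Euc d) x).target →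
    TendstoUniformlyOn
      (fun n => iteratedFDeriv ℝ k ((f n : M → ℂ) ∘ (chartAt (Euc d) x).symm))
      (iteratedFDeriv ℝ k ((f₀ : M → ℂ) ∘ (chartAt (Euc d) x).symm)) atTop C

/-! ### Schwartz functions on `M` relative to an embedding -/

/-- Proper real analytic embeddings `ι : M → ℝⁿ`. -/
structure IsProperAnalyticEmbedding {n : ℕ} (ι : M → Euc n) : Prop where
  embedding : Manifold.IsSmoothEmbedding (𝓡 d) 𝓘(ℝ, Euc n) ω ι
  proper : IsProperMap ι

end Manifold

section Restriction

variable {M : Type*} {n : ℕ}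

/-- The pull-back of Schwartz functions along `ι`, as a linear map to functions on `M`. -/
def pullback (ι : M → Euc n) : 𝓢(Euc n, ℂ) →ₗ[ℂ] (M → ℂ) where
  toFun F := fun x => F (ι x)
  map_add' _ _ := rfl
  map_smul' _ _ := rfl

/-- `𝒮(M) = ι^* 𝒮(ℝⁿ)`, the space of restrictions of Schwartz functions with the quotient
topology, as the quotient of `𝒮(ℝⁿ)` by the functions that vanish on `ι(M)`. -/
abbrev SchwartzOn (ι : M → Euc n) : Type := 𝓢(Euc n, ℂ) ⧸ LinearMap.ker (pullback ι)

/-- The restriction map `ι^* : 𝒮(ℝⁿ) → 𝒮(M)`. -/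
def restrict (ι : M → Euc n) : 𝓢(Euc n, ℂ) →ₗ[ℂ] SchwartzOn ι :=
  (LinearMap.ker (pullback ι)).mkQ

/-- `𝒮_a(M) = ι^* 𝓕(C₀^∞(ℝⁿ))`. -/
def analyticSchwartz (ι : M → Euc n) : Set (SchwartzOn ι) :=
  {g | ∃ u : 𝓢(Euc n, ℂ), HasCompactSupport u ∧ g = restrict ι (𝓕 u)}

/-- `𝒮_{h,O}(M) = ι^* 𝒮_{h,O}(ℝⁿ)`. -/
def ZeroEnergyOn (ι : M → Euc n) (q : ℝ → SchwartzOn ι) : Prop :=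
  ∃ F : ℝ → 𝓢(Euc n, ℂ), ZeroEnergy F ∧ ∀ h, q h = restrict ι (F h)

variable {d : ℕ} [TopologicalSpace M] [ChartedSpace (Euc d) M] [IsManifold (𝓡 d) ω M]

/-- The pull-back `(x, dι(x)^T η) ∈ T*M` of the covector `(ι(x), η) ∈ ℝⁿ × ℝⁿ`. -/
def pullCovector (ι : M → Euc n) (x : M) (η : Euc n) : Cotangent d M :=
  ⟨x, (innerSL ℝ η).comp (mfderiv (𝓡 d) 𝓘(ℝ, Euc n) ι x)⟩

/-- `(f_h) ∈ 𝒮_h(M) = ι^* 𝒮_h(ℝⁿ)` is uniformly microsupported in `K ⊆ T*M`: it is the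
restriction of a polynomially bounded family of Schwartz functions on `ℝⁿ` that is uniformly
microsupported in a compact set `L`, the covectors of `L` over points of `M` being mapped into
`K` by the pull-back. -/
def UniformlyMicrosupportedOn (ι : M → Euc n) (f : ℝ → SchwartzOn ι)
    (K : Set (Cotangent d M)) : Prop :=
  ∃ (F : ℝ → 𝓢(Euc n, ℂ)) (L : Set (Euc n × Euc n)),
    PolynomiallyBounded F ∧ IsCompact L ∧ UniformlyMicrosupportedIn F L ∧
    (∀ (x : M) (η : Euc n), (ι x, η) ∈ L → pullCovector ι x η ∈ K) ∧
    ∀ h, f h = restrict ι (F h)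

end Restriction

/-! ### Quantum fields -/

section Field

variable (d : ℕ) (M : Type*) [TopologicalSpace M] [ChartedSpace (Euc d) M]
  [IsManifold (𝓡 d) ω M]
  (H : Type*) [NormedAddCommGroup H] [InnerProductSpace ℂ H] [CompleteSpace H]

/-- A quantum field on `M`: an operator-valued distribution `Φ : C₀^∞(M) → End(D)` on a dense
domain `D` of the Hilbert space `H`, with `Φ(f)` symmetric for real-valued `f`. -/
structure QuantumField where
  D : Submodule ℂ H
  dense : Dense (D : Set H)
  Φ : testFunctions d M →ₗ[ℂ] Module.End ℂ D
  continuous : ∀ (v : D) (f : ℕ → testFunctions d M) (f₀ : testFunctions d M),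
    TestConverges f f₀ → Tendsto (fun n => (Φ (f n) v : H)) atTop (𝓝 (Φ f₀ v : H))
  symmetric : ∀ f : testFunctions d M, (∀ x, (starRingEnd ℂ) ((f : M → ℂ) x) = (f : M → ℂ) x) →
    ∀ v w : D, ⟪(Φ f v : H), (w : H)⟫_ℂ = ⟪(v : H), (Φ f w : H)⟫_ℂ

variable {d M H}

/-- `Ω ∈ D` is cyclic for the algebra `𝒜` generated by the `Φ(f)`, `f ∈ C₀^∞(M)`: the set `𝒜 Ω`
is dense in `H`. -/
def QuantumField.IsCyclic (Q : QuantumField d M H) (Ω : Q.D) : Prop :=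
  Dense {v : H | ∃ A ∈ Algebra.adjoin ℂ (Set.range Q.Φ), v = (A Ω : Q.D)}

/-- An extension of the field, as an operator-valued distribution on the same domain, to the test
function space `𝒮(M)` defined by `ι`. -/
structure TemperedExtension (Q : QuantumField d M H) {n : ℕ} (ι : M → Euc n) where
  Φ : SchwartzOn ι →ₗ[ℂ] Module.End ℂ Q.D
  continuous : ∀ v : Q.D, Continuous fun f : SchwartzOn ι => (Φ f v : H)
  extends_field : ∀ (f : testFunctions d M) (F : 𝓢(Euc n, ℂ)),
    pullback ι F = f → Φ (restrict ι F) = Q.Φ f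

/-- The product `Φ(g₁) ⋯ Φ(g_m)` of smeared fields, for `g₁, …, g_m ∈ 𝒮(M)`. -/
def TemperedExtension.prod {Q : QuantumField d M H} {n : ℕ} {ι : M → Euc n}
    (E : TemperedExtension Q ι) (g : List (SchwartzOn ι)) : Module.End ℂ Q.D :=
  (g.map E.Φ).prod

/-- Tempered analytic vectors: `‖Φ(f_h) Φ(q_{1,h}) ⋯ Φ(q_{m,h}) Ω‖ = O(e^{-δ/h})` as `h ↘ 0`, for
some `δ > 0`, whenever `(f_h) ∈ 𝒮_h(M)` is uniformly microsupported in a compact set that does not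
meet the closed past light cones and `(q_{1,h}), …, (q_{m,h}) ∈ 𝒮_{h,O}(M)`, `m ≥ 0`. -/
def IsTemperedAnalytic (S : Spacetime d M) {Q : QuantumField d M H} {n : ℕ} {ι : M → Euc n}
    (E : TemperedExtension Q ι) (Ω : Q.D) : Prop :=
  ∀ (K : Set (Cotangent d M)), IsCompact K → Disjoint K S.pastCone →
  ∀ f : ℝ → SchwartzOn ι, UniformlyMicrosupportedOn ι f K →
  ∀ q : List (ℝ → SchwartzOn ι), (∀ p ∈ q, ZeroEnergyOn ι p) →
    ∃ δ > 0, (fun h => ‖(E.Φ (f h) (E.prod (q.map fun p => p h) Ω) : H)‖)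
      =O[𝓝[>] (0 : ℝ)] fun h => Real.exp (-δ / h)

end Field

end TemperedQFT

end

/-! The first assertion is nearly built into the definition: tempered analyticity already allows
arbitrary zero-energy insertions in front of `Ω`. So it suffices that, for compactly supported `u`,
the constant family `𝓕 u` is a zero-energy family (`zeroEnergy_fourier`). At semi-classical scale a
fixed frequency `k` sits at covector size `h‖k‖`, so bounded frequencies collapse onto the zero
section. Quantitatively, the Fourier transform of a wave packet at `ξ` is a Gaussian centred at
`-ξ/(2πh)`, which leaves the support of `u` as `h ↘ 0`.

For density, cyclicity reduces matters to products of fields applied to `Ω`, whose test functions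
extend to Schwartz functions (`exists_pullback_eq`). The factors are replaced from right to left by
elements of `𝒮_a(M)`, which come from a dense subspace of the Schwartz space. The obstacle is that
the operators to the left are unbounded, so continuity of `F ↦ Φ(g₁) ⋯ Φ(g_m) Φ(F) v` is not given.
It is proved in `continuous_prod_apply`: hermiticity moves the left factors to the other side of the
inner product, so the norm of this vector is a lower semicontinuous seminorm of `F`. The Schwartz
space is complete and metrizable, hence Baire and barrelled, and such a seminorm is continuous. -/

noncomputable section

namespace SchwartzMap

/-! ### Completeness and the Baire property of the Schwartz space -/

section Complete

variable {E F : Type*} [NormedAddCommGroup E] [NormedSpace ℝ E] [NormedAddCommGroup F]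
  [NormedSpace ℝ F]

lemma tendsto_of_seminorm_sub {α : Type*} {l : Filter α} {f : α → 𝓢(E, F)} {g : 𝓢(E, F)}
    (h : ∀ k m : ℕ, Tendsto (fun a => SchwartzMap.seminorm ℝ k m (f a - g)) l (𝓝 0)) :
    Tendsto f l (𝓝 g) := by
  rw [(schwartz_withSeminorms ℝ E F).tendsto_nhds]
  intro i ε hε
  exact (h i.1 i.2).eventually (gt_mem_nhds hε)

lemma cauchySeq_seminorm {f : ℕ → 𝓢(E, F)} (hf : CauchySeq f) (k l : ℕ) {ε : ℝ} (hε : 0 < ε) :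
    ∃ N, ∀ m ≥ N, ∀ n ≥ N, SchwartzMap.seminorm ℝ k l (f m - f n) < ε := by
  have h0 : Tendsto (fun p : ℕ × ℕ => f p.2 - f p.1) atTop (𝓝 0) := by
    have := cauchySeq_iff_tendsto.1 hf
    rw [uniformity_eq_comap_nhds_zero, tendsto_comap_iff] at this
    exact this
  rw [(schwartz_withSeminorms ℝ E F).tendsto_nhds] at h0
  obtain ⟨N, hN⟩ := eventually_atTop.1 (h0 (k, l) ε hε)
  refine ⟨max N.1 N.2, fun m hm n hn => ?_⟩
  have := hN (n, m) ⟨(le_max_left _ _).trans hn, (le_max_right _ _).trans hm⟩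
  simpa using! this

/-- The topology is countably generated, so sequences suffice. All derivatives of a Cauchy sequence
converge uniformly, and the weighted Cauchy bounds pass to the pointwise limits. -/
instance instCompleteSpace [CompleteSpace F] : CompleteSpace 𝓢(E, F) := by
  have : (uniformity 𝓢(E, F)).IsCountablyGenerated :=
    IsUniformAddGroup.uniformity_countably_generated
  refine UniformSpace.complete_of_cauchySeq_tendsto fun f hf => ?_
  have hbound : ∀ (k l m n : ℕ) (x : E), ‖x‖ ^ k * ‖iteratedFDeriv ℝ l (f m) x -
      iteratedFDeriv ℝ l (f n) x‖ ≤ SchwartzMap.seminorm ℝ k l (f m - f n) := by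
    intro k l m n x
    have h := SchwartzMap.le_seminorm ℝ k l (f m - f n) x
    have e : iteratedFDeriv ℝ l (f m - f n) x
        = iteratedFDeriv ℝ l (f m) x - iteratedFDeriv ℝ l (f n) x :=
      iteratedFDeriv_sub_apply ((f m).smooth l).contDiffAt ((f n).smooth l).contDiffAt
    rw [← e]
    exact h
  have hpt : ∀ (l : ℕ) (x : E), ∃ y, Tendsto (fun n => iteratedFDeriv ℝ l (f n) x) atTop (𝓝 y) := by
    intro l x
    refine cauchySeq_tendsto_of_complete (Metric.cauchySeq_iff.2 fun ε hε => ?_)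
    obtain ⟨N, hN⟩ := cauchySeq_seminorm hf 0 l hε
    refine ⟨N, fun m hm n hn => ?_⟩
    rw [dist_eq_norm]
    have := hbound 0 l m n x
    rw [pow_zero, one_mul] at this
    exact this.trans_lt (hN m hm n hn)
  choose g hg using fun (x : E) (l : ℕ) => hpt l x
  have hlim : ∀ (k l : ℕ) {ε : ℝ}, 0 < ε → ∃ N, ∀ n ≥ N, ∀ x : E,
      ‖x‖ ^ k * ‖iteratedFDeriv ℝ l (f n) x - g x l‖ ≤ ε := by
    intro k l ε hε
    obtain ⟨N, hN⟩ := cauchySeq_seminorm hf k l hε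
    refine ⟨N, fun n hn x => ?_⟩
    refine le_of_tendsto (((tendsto_const_nhds (x := iteratedFDeriv ℝ l (f n) x)).sub
      (hg x l)).norm.const_mul (‖x‖ ^ k)) ?_
    filter_upwards [eventually_ge_atTop N] with m hm
    exact (hbound k l n m x).trans (hN n hn m hm).le
  have hunif : ∀ l : ℕ, TendstoUniformly (fun n => iteratedFDeriv ℝ l (f n)) (fun x => g x l)
      atTop := by
    intro l
    rw [Metric.tendstoUniformly_iff]
    intro ε hε
    obtain ⟨N, hN⟩ := hlim 0 l (half_pos hε)
    filter_upwards [eventually_ge_atTop N] with n hn x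
    have := hN n hn x
    rw [pow_zero, one_mul] at this
    rw [dist_comm, dist_eq_norm]
    linarith
  -- Uniform convergence in every order permits differentiation of the limit, so the limits `g x l`
  -- fit together as the Taylor series of a single smooth function.
  have htaylor : HasFTaylorSeriesUpTo (∞ : ℕ∞ω) (fun x => (g x 0).curry0) g := by
    refine ⟨fun x => rfl, fun m _ x => ?_, fun m _ => ?_⟩
    · refine hasFDerivAt_of_tendstoUniformly (l := atTop) (f := fun n => iteratedFDeriv ℝ m (f n))
        (f' := fun n x => (iteratedFDeriv ℝ (m + 1) (f n) x).curryLeft)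
        (g' := fun x => (g x (m + 1)).curryLeft) ?_ ?_ (fun x => hg x m) x
      · rw [Metric.tendstoUniformly_iff]
        intro ε hε
        filter_upwards [Metric.tendstoUniformly_iff.1 (hunif (m + 1)) ε hε] with n hn x
        refine lt_of_le_of_lt (le_of_eq ?_) (hn x)
        exact (continuousMultilinearCurryLeftEquiv ℝ (fun _ : Fin (m + 1) => E) F).dist_map _ _
      · intro n x
        have h := (contDiff_iff_ftaylorSeries.1 ((f n).smooth ⊤)).fderiv m
          (by exact_mod_cast ENat.natCast_lt_top m) x
        exact h
    · exact (hunif m).continuous (Frequently.of_forall fun n =>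
        ((f n).smooth m).continuous_iteratedFDeriv le_rfl)
  have hder : ∀ (l : ℕ) (x : E), iteratedFDeriv ℝ l (fun x => (g x 0).curry0) x = g x l :=
    fun l x => (htaylor.eq_iteratedFDeriv (by exact_mod_cast le_top) x).symm
  let G : 𝓢(E, F) :=
    { toFun := fun x => (g x 0).curry0
      smooth' := htaylor.contDiff
      decay' := by
        intro k l
        obtain ⟨N, hN⟩ := hlim k l one_pos
        refine ⟨SchwartzMap.seminorm ℝ k l (f N) + 1, fun x => ?_⟩
        rw [hder]
        calc ‖x‖ ^ k * ‖g x l‖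
            ≤ ‖x‖ ^ k * (‖iteratedFDeriv ℝ l (f N) x‖ + ‖iteratedFDeriv ℝ l (f N) x - g x l‖) := by
              gcongr
              rw [add_comm, norm_sub_rev]
              exact norm_le_norm_sub_add _ _
          _ ≤ _ := by
              rw [mul_add]
              exact add_le_add (SchwartzMap.le_seminorm ℝ k l (f N) x) (hN N le_rfl x) }
  refine ⟨G, tendsto_of_seminorm_sub fun k l => ?_⟩
  rw [Metric.tendsto_atTop]
  intro ε hε
  obtain ⟨N, hN⟩ := hlim k l (half_pos hε)
  refine ⟨N, fun n hn => ?_⟩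
  rw [Real.dist_eq, sub_zero, abs_of_nonneg (apply_nonneg _ _)]
  refine lt_of_le_of_lt (SchwartzMap.seminorm_le_bound ℝ k l (f n - G) (half_pos hε).le
    fun x => ?_) (half_lt_self hε)
  have e : iteratedFDeriv ℝ l (f n - G) x = iteratedFDeriv ℝ l (f n) x - g x l := by
    rw [← hder]
    exact iteratedFDeriv_sub_apply ((f n).smooth l).contDiffAt (G.smooth l).contDiffAt
  have := hN n hn x
  rw [← e] at this
  exact this

/-- This supplies the barrelledness used in `continuous_prod_apply`. -/
instance instBaireSpace [CompleteSpace F] : BaireSpace 𝓢(E, F) := by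
  have : (uniformity 𝓢(E, F)).IsCountablyGenerated :=
    IsUniformAddGroup.uniformity_countably_generated
  infer_instance

end Complete

/-! ### Dense subspaces of the Schwartz space -/

section Dense

variable {E : Type*} [NormedAddCommGroup E] [InnerProductSpace ℝ E] [FiniteDimensional ℝ E]

lemma exists_bound_iteratedFDeriv_bump_sub_one (χ : ContDiffBump (0 : E)) (i : ℕ) :
    ∃ C, 0 ≤ C ∧ ∀ x, ‖iteratedFDeriv ℝ i (fun x => ((χ x : ℝ) : ℂ) - 1) x‖ ≤ C := by
  have hχ : ContDiff ℝ ∞ (fun x => ((χ x : ℝ) : ℂ)) :=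
    Complex.ofRealCLM.contDiff.comp χ.contDiff
  have hs : HasCompactSupport (fun x => ((χ x : ℝ) : ℂ)) :=
    χ.hasCompactSupport.comp_left (g := fun r : ℝ => (r : ℂ)) Complex.ofReal_zero
  obtain ⟨C, hC⟩ := ((hs.iteratedFDeriv (𝕜 := ℝ) i).exists_bound_of_continuous
    (hχ.continuous_iteratedFDeriv (by exact_mod_cast le_top)))
  refine ⟨C + 1, by linarith [(norm_nonneg _).trans (hC 0)], fun x => ?_⟩
  have e : iteratedFDeriv ℝ i (fun x => ((χ x : ℝ) : ℂ) - 1) x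
      = iteratedFDeriv ℝ i (fun x => ((χ x : ℝ) : ℂ)) x - iteratedFDeriv ℝ i (fun _ => (1 : ℂ)) x :=
    iteratedFDeriv_sub_apply ((hχ.of_le (by exact_mod_cast le_top)).contDiffAt)
      contDiff_const.contDiffAt
  rw [e]
  refine (norm_sub_le _ _).trans (add_le_add (hC x) ?_)
  rcases Nat.eq_zero_or_pos i with rfl | hi
  · rw [norm_iteratedFDeriv_zero]; simp
  · rw [iteratedFDeriv_const_of_ne hi.ne']; simp

/-- Compactly supported functions are dense in the Schwartz space. -/
theorem dense_hasCompactSupport : Dense {f : 𝓢(E, ℂ) | HasCompactSupport f} := by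
  intro f
  let χ : ContDiffBump (0 : E) := ⟨1, 2, one_pos, one_lt_two⟩
  let c : ℕ → ℝ := fun m => ((m : ℝ) + 1)⁻¹
  have hc : ∀ m, 0 < c m := fun m => by positivity
  have hc1 : ∀ m, c m ≤ 1 := fun m => inv_le_one_of_one_le₀ (by simp)
  have hχ : ∀ m, ContDiff ℝ ∞ (fun x => ((χ (c m • x) : ℝ) : ℂ)) := fun m =>
    Complex.ofRealCLM.contDiff.comp (χ.contDiff.comp (contDiff_const_smul (c m)))
  have hs : ∀ m, HasCompactSupport (fun x => ((χ (c m • x) : ℝ) : ℂ) * f x) := by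
    intro m
    have : HasCompactSupport (fun x => ((χ (c m • x) : ℝ) : ℂ)) :=
      (χ.hasCompactSupport.comp_left (g := fun r : ℝ => (r : ℂ)) Complex.ofReal_zero).comp_smul
        (hc m).ne'
    exact this.mul_right
  have hd : ∀ m, ContDiff ℝ ∞ (fun x => ((χ (c m • x) : ℝ) : ℂ) * f x) := fun m =>
    (hχ m).mul (f.smooth ⊤)
  let F : ℕ → 𝓢(E, ℂ) := fun m => (hs m).toSchwartzMap (hd m)
  refine mem_closure_of_tendsto (b := atTop) (f := F) ?_ (Eventually.of_forall fun m => hs m)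
  refine tendsto_of_seminorm_sub fun k l => ?_
  choose C hC0 hC using exists_bound_iteratedFDeriv_bump_sub_one χ
  -- The factor `χ(c x) - 1` vanishes where `c‖x‖ < 1`; elsewhere `1 ≤ c‖x‖`. Each of its
  -- derivatives thus gains a factor `c‖x‖`, paid for by the weight `k + 1` in place of `k`.
  let B : ℝ := ∑ i ∈ Finset.range (l + 1), (l.choose i : ℝ) * C i *
    SchwartzMap.seminorm ℝ (k + 1) (l - i) f
  have hB : 0 ≤ B := Finset.sum_nonneg fun i _ => mul_nonneg
    (mul_nonneg (Nat.cast_nonneg _) (hC0 i)) (apply_nonneg _ _)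
  have hdc : ContDiff ℝ ∞ (fun x : E => ((χ x : ℝ) : ℂ) - 1) :=
    (Complex.ofRealCLM.contDiff.comp χ.contDiff).sub contDiff_const
  have key : ∀ m, SchwartzMap.seminorm ℝ k l (F m - f) ≤ c m * B := by
    intro m
    refine SchwartzMap.seminorm_le_bound ℝ k l _ (mul_nonneg (hc m).le hB) fun x => ?_
    have e : (⇑(F m - f) : E → ℂ) = fun x => (((χ (c m • x) : ℝ) : ℂ) - 1) * f x := by
      ext x
      change ((χ (c m • x) : ℝ) : ℂ) * f x - f x = _
      ring
    rw [e]
    have hi : ∀ i x, ‖iteratedFDeriv ℝ i (fun x => ((χ (c m • x) : ℝ) : ℂ) - 1) x‖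
        ≤ c m * ‖x‖ * C i := by
      intro i x
      by_cases hx : ‖x‖ * c m < 1
      · have : (fun x => ((χ (c m • x) : ℝ) : ℂ) - 1) =ᶠ[𝓝 x] fun _ => 0 := by
          have ho : IsOpen {y : E | ‖y‖ * c m < 1} := isOpen_lt (by fun_prop) (by fun_prop)
          filter_upwards [ho.mem_nhds hx] with y hy
          rw [χ.one_of_mem_closedBall]
          · simp
          · rw [mem_closedBall_zero_iff, norm_smul, Real.norm_of_nonneg (hc m).le, mul_comm]
            exact (le_of_lt hy)
        rw [(this.iteratedFDeriv ℝ i).eq_of_nhds]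
        have h0 : iteratedFDeriv ℝ i (fun _ : E => (0 : ℂ)) x = 0 := by
          simp
        rw [h0, norm_zero]
        exact mul_nonneg (mul_nonneg (hc m).le (norm_nonneg _)) (hC0 i)
      · have h1 := iteratedFDeriv_comp_const_smul (𝕜 := ℝ) (i := i) (c m)
          (hdc.of_le (by exact_mod_cast le_top))
        have h2 := congrFun h1 x
        have h3 : iteratedFDeriv ℝ i (fun x => ((χ (c m • x) : ℝ) : ℂ) - 1) x = _ := h2
        rw [h3, norm_smul, norm_pow, Real.norm_of_nonneg (hc m).le]
        have h4 : 1 ≤ c m * ‖x‖ := by rw [mul_comm]; exact not_lt.1 hx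
        exact mul_le_mul ((pow_le_one₀ (hc m).le (hc1 m)).trans h4) (hC i _) (norm_nonneg _)
          (zero_le_one.trans h4)
    have hL := norm_iteratedFDeriv_mul_le (𝕜 := ℝ) (N := ∞) (A := ℂ)
      (f := fun x => ((χ (c m • x) : ℝ) : ℂ) - 1) ((hχ m).sub contDiff_const) (f.smooth ⊤) x (n := l) (by exact_mod_cast le_top)
    refine (mul_le_mul_of_nonneg_left hL (by positivity)).trans ?_
    rw [Finset.mul_sum, Finset.mul_sum]
    refine Finset.sum_le_sum fun i _ => ?_
    have hf := SchwartzMap.le_seminorm ℝ (k + 1) (l - i) f x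
    calc ‖x‖ ^ k * ((l.choose i : ℝ) *
          ‖iteratedFDeriv ℝ i (fun x => ((χ (c m • x) : ℝ) : ℂ) - 1) x‖ *
            ‖iteratedFDeriv ℝ (l - i) f x‖)
        ≤ ‖x‖ ^ k * ((l.choose i : ℝ) * (c m * ‖x‖ * C i) * ‖iteratedFDeriv ℝ (l - i) f x‖) := by
          gcongr
          exact hi i x
      _ = c m * ((l.choose i : ℝ) * C i * (‖x‖ ^ (k + 1) * ‖iteratedFDeriv ℝ (l - i) f x‖)) := by
          ring
      _ ≤ _ := by
          have := hC0 i
          have := (hc m).le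
          gcongr
  have hlim : Tendsto (fun m => c m * B) atTop (𝓝 0) := by
    have h0 : Tendsto c atTop (𝓝 0) := by
      simpa [c, one_div] using tendsto_one_div_add_atTop_nhds_zero_nat (𝕜 := ℝ)
    simpa using h0.mul_const B
  exact squeeze_zero (fun m => apply_nonneg _ _) key hlim

/-- Fourier transforms of compactly supported functions are dense in the Schwartz space. -/
theorem dense_fourier_hasCompactSupport [MeasurableSpace E] [BorelSpace E] :
    Dense {f : 𝓢(E, ℂ) | ∃ u : 𝓢(E, ℂ), HasCompactSupport u ∧ f = 𝓕 u} := by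
  have h := (FourierTransform.fourierCLE ℂ 𝓢(E, ℂ)).surjective.denseRange.dense_image
    (FourierTransform.fourierCLE ℂ 𝓢(E, ℂ)).continuous (dense_hasCompactSupport (E := E))
  refine h.mono ?_
  rintro _ ⟨u, hu, rfl⟩
  exact ⟨u, hu, rfl⟩

end Dense

end SchwartzMap

end

/-! ### FBI transform estimates -/

noncomputable section

lemma one_add_pow_le_factorial_mul_exp (N : ℕ) {t : ℝ} (ht : 0 ≤ t) :
    (1 + t) ^ N ≤ N.factorial * Real.exp 1 * Real.exp t := by
  have h := Real.pow_div_factorial_le_exp (1 + t) (by positivity) N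
  rw [div_le_iff₀ (by positivity), Real.exp_add] at h
  linarith

/-- Half of the exponential decay is spent on absorbing the power of `h`, by `(a/h)ⁿ ≤ n! e^{a/h}`.
-/
lemma inv_pow_mul_exp_neg_le (n : ℕ) {a : ℝ} (ha : 0 < a) {h : ℝ} (hh : 0 < h) :
    (h ^ n)⁻¹ * Real.exp (-(2 * a) / h) ≤ n.factorial * (a ^ n)⁻¹ * Real.exp (-a / h) := by
  have h1 := Real.pow_div_factorial_le_exp (a / h) (by positivity) n
  rw [div_le_iff₀ (by positivity), div_pow] at h1
  have h2 : (h ^ n)⁻¹ ≤ n.factorial * (a ^ n)⁻¹ * Real.exp (a / h) := by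
    have : (h ^ n)⁻¹ = (a ^ n)⁻¹ * (a ^ n / h ^ n) := by field_simp
    rw [this]
    calc (a ^ n)⁻¹ * (a ^ n / h ^ n) ≤ (a ^ n)⁻¹ * (Real.exp (a / h) * n.factorial) := by gcongr
      _ = _ := by ring
  calc (h ^ n)⁻¹ * Real.exp (-(2 * a) / h)
      ≤ (n.factorial * (a ^ n)⁻¹ * Real.exp (a / h)) * Real.exp (-(2 * a) / h) := by gcongr
    _ = n.factorial * (a ^ n)⁻¹ * Real.exp (-a / h) := by
        rw [mul_assoc, ← Real.exp_add]
        congr 2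
        ring

namespace TemperedQFT

variable {n : ℕ}

/-- The Gaussian wave packet `z ↦ e^{-z²/(2h)} e^{(i/h) z·ξ}`. -/
def wavePacket (h : ℝ) (ξ z : Euc n) : ℂ :=
  Complex.exp (-((1 / (2 * h) : ℝ) : ℂ) * (‖z‖ : ℂ) ^ 2 +
    Complex.I * ((⟪(1 / h) • ξ, z⟫_ℝ : ℝ) : ℂ))

lemma norm_wavePacket (h : ℝ) (ξ z : Euc n) :
    ‖wavePacket h ξ z‖ = Real.exp (-(‖z‖ ^ 2 / (2 * h))) := by
  rw [wavePacket, Complex.norm_exp]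
  congr 1
  simp only [Complex.add_re, Complex.mul_re, Complex.I_re, Complex.I_im, Complex.ofReal_re,
    Complex.ofReal_im, Complex.neg_re, Complex.neg_im, ← Complex.ofReal_pow]
  ring

lemma integrable_wavePacket {h : ℝ} (hh : 0 < h) (ξ : Euc n) :
    MeasureTheory.Integrable (wavePacket h ξ) :=
  GaussianFourier.integrable_cexp_neg_mul_sq_norm_add
    (by rw [Complex.ofReal_re]; positivity) _ _

lemma fbi_eq_integral_wavePacket (h : ℝ) (f : 𝓢(Euc n, ℂ)) (x ξ : Euc n) :
    fbi h f x ξ = (((2 : ℝ) ^ (-(n : ℝ) / 2) * (Real.pi * h) ^ (-(3 * (n : ℝ)) / 4) : ℝ) : ℂ) *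
      ∫ y : Euc n, wavePacket h ξ (x - y) * f y := by
  rw [fbi]
  congr 2
  ext y
  congr 1
  rw [wavePacket, Complex.exp_add, Complex.ofReal_exp]
  congr 2
  · push_cast; ring
  · rw [real_inner_smul_left, real_inner_comm]
    congr 2
    ring

lemma norm_fbi_prefactor_le {h : ℝ} (hh : 0 < h) (h1 : h ≤ 1) :
    ‖(((2 : ℝ) ^ (-(n : ℝ) / 2) * (Real.pi * h) ^ (-(3 * (n : ℝ)) / 4) : ℝ) : ℂ)‖ ≤ (h ^ n)⁻¹ := by
  have hn : (0 : ℝ) ≤ n := Nat.cast_nonneg n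
  rw [Complex.norm_real, Real.norm_of_nonneg (by positivity), ← Real.rpow_natCast,
    ← Real.rpow_neg hh.le, ← one_mul (h ^ (-(n : ℝ)))]
  have hpi : h ≤ Real.pi * h := by nlinarith [Real.pi_gt_three]
  refine mul_le_mul (Real.rpow_le_one_of_one_le_of_nonpos one_le_two (by linarith)) ?_
    (by positivity) zero_le_one
  calc (Real.pi * h) ^ (-(3 * (n : ℝ)) / 4) ≤ h ^ (-(3 * (n : ℝ)) / 4) :=
        Real.rpow_le_rpow_of_nonpos hh hpi (by linarith)
    _ ≤ h ^ (-(n : ℝ)) := Real.rpow_le_rpow_of_exponent_ge hh h1 (by linarith)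

/-- The modulus of the Fourier transform of a Gaussian wave packet. -/
lemma norm_fourier_wavePacket {h : ℝ} (hh : 0 < h) (x ξ k : Euc n) :
    ‖𝓕 (fun y => wavePacket h ξ (x - y)) k‖ =
      (2 * Real.pi * h) ^ ((n : ℝ) / 2) *
        Real.exp (-(h / 2 * ‖(1 / h) • ξ + (2 * Real.pi) • k‖ ^ 2)) := by
  rw [Real.fourier_eq]
  -- In the variable `z = x - y` the character shifts the frequency of the packet to `ξ/h + 2πk` and
  -- leaves a unimodular constant.
  let G : Euc n → ℂ := fun z => Complex.exp (((-2 * Real.pi * ⟪x, k⟫_ℝ : ℝ) : ℂ) * Complex.I) *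
    Complex.exp (-((1 / (2 * h) : ℝ) : ℂ) * (‖z‖ : ℂ) ^ 2 +
      Complex.I * ((⟪(1 / h) • ξ + (2 * Real.pi) • k, z⟫_ℝ : ℝ) : ℂ))
  have e1 : (fun y : Euc n => Real.fourierChar (-⟪y, k⟫_ℝ) • wavePacket h ξ (x - y)) =
      fun y => G (x - y) := by
    ext y
    simp only [G]
    rw [wavePacket, Circle.smul_def, Real.fourierChar_apply, smul_eq_mul, ← Complex.exp_add,
      ← Complex.exp_add]
    congr 1
    rw [inner_add_left, real_inner_smul_left k, inner_sub_right k, real_inner_comm x k,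
      real_inner_comm y k]
    push_cast
    ring
  rw [e1, MeasureTheory.integral_sub_left_eq_self G, MeasureTheory.integral_const_mul, norm_mul,
    Complex.norm_exp_ofReal_mul_I, one_mul,
    GaussianFourier.integral_cexp_neg_mul_sq_norm_add
      (by rw [Complex.ofReal_re]; positivity), norm_mul, Complex.norm_exp]
  congr 1
  · have : (Real.pi : ℂ) / ((1 / (2 * h) : ℝ) : ℂ) = ((2 * Real.pi * h : ℝ) : ℂ) := by
      push_cast; field_simp
    rw [this, Complex.norm_cpow_eq_rpow_re_of_pos (by positivity)]
    simp
  · congr 1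
    have : Complex.I ^ 2 * ((‖(1 / h) • ξ + (2 * Real.pi) • k‖ : ℝ) : ℂ) ^ 2 /
        (4 * ((1 / (2 * h) : ℝ) : ℂ)) =
        ((-(h / 2 * ‖(1 / h) • ξ + (2 * Real.pi) • k‖ ^ 2) : ℝ) : ℂ) := by
      rw [Complex.I_sq]; push_cast; field_simp; ring
    rw [this, Complex.ofReal_re]

/-- Moving the Fourier transform onto the packet restricts the integral to the support of `u`. -/
lemma integral_wavePacket_mul_fourier {h : ℝ} (hh : 0 < h) (u : 𝓢(Euc n, ℂ)) (x ξ : Euc n) :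
    ∫ y, wavePacket h ξ (x - y) * (𝓕 u) y =
      ∫ k, 𝓕 (fun y => wavePacket h ξ (x - y)) k * u k := by
  have := (VectorFourier.integral_fourierIntegral_smul_eq_flip (L := innerₗ (Euc n))
      Real.continuous_fourierChar continuous_inner ((integrable_wavePacket hh ξ).comp_sub_left x)
      (u.integrable (μ := MeasureTheory.volume))).symm
  simpa using! this

/-- Decay in `ξ` of the FBI transform of the Fourier transform of a compactly supported
function. -/
lemma exists_norm_fbi_fourier_le (u : 𝓢(Euc n, ℂ)) (hu : HasCompactSupport u) {ε : ℝ}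
    (hε : 0 < ε) (N : ℕ) : ∃ C, 0 ≤ C ∧ ∀ᶠ h in 𝓝[>] (0 : ℝ), ∀ x ξ : Euc n, ε < ‖ξ‖ →
      (1 + ‖ξ‖ ^ 2) ^ N * ‖fbi h (𝓕 u) x ξ‖ ≤
        C * ((h ^ n)⁻¹ * Real.exp (-(ε ^ 2 / 16) / h)) := by
  obtain ⟨R, hR0, hR⟩ : ∃ R > 0, ∀ k, u k ≠ 0 → ‖k‖ ≤ R := by
    obtain ⟨R, hR⟩ := hu.isCompact.isBounded.exists_norm_le
    exact ⟨max R 1, by positivity, fun k hk =>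
      (hR k (subset_tsupport _ hk)).trans (le_max_left _ _)⟩
  let A : ℝ := (2 * Real.pi) ^ ((n : ℝ) / 2) * ∫ k, ‖u k‖
  have hA : 0 ≤ A := mul_nonneg (by positivity)
    (MeasureTheory.integral_nonneg fun _ => norm_nonneg _)
  refine ⟨16 ^ N * (N.factorial * Real.exp 1) * A, by positivity, ?_⟩
  -- For such `h` and `‖ξ‖ > ε`, the support of `u` satisfies `2π‖k‖ ≤ 2πR ≤ ‖ξ‖/(2h)`, so at least
  -- half of `‖ξ‖/h` survives in the Gaussian exponent.
  have hpos : 0 < min 1 (ε / (4 * Real.pi * R)) := lt_min one_pos (by positivity)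
  filter_upwards [Ioo_mem_nhdsGT hpos] with h hh x ξ hξ
  obtain ⟨hh0, hh1⟩ := hh
  have hle1 : h ≤ 1 := (hh1.trans_le (min_le_left _ _)).le
  have hle2 : h * (4 * Real.pi * R) ≤ ε :=
    ((lt_div_iff₀ (by positivity)).1 (hh1.trans_le (min_le_right _ _))).le
  have hint : ‖∫ y, wavePacket h ξ (x - y) * (𝓕 u) y‖ ≤
      A * Real.exp (-(‖ξ‖ ^ 2 / (8 * h))) := by
    rw [integral_wavePacket_mul_fourier hh0]
    have hb : ∀ k, ‖𝓕 (fun y => wavePacket h ξ (x - y)) k * u k‖ ≤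
        (2 * Real.pi) ^ ((n : ℝ) / 2) * Real.exp (-(‖ξ‖ ^ 2 / (8 * h))) * ‖u k‖ := by
      intro k
      by_cases hk : u k = 0
      · simp [hk]
      rw [norm_mul, norm_fourier_wavePacket hh0]
      refine mul_le_mul_of_nonneg_right ?_ (norm_nonneg _)
      have hpw : (2 * Real.pi * h) ^ ((n : ℝ) / 2) ≤ (2 * Real.pi) ^ ((n : ℝ) / 2) :=
        Real.rpow_le_rpow (by positivity) (by nlinarith [Real.pi_pos]) (by positivity)
      refine mul_le_mul hpw (Real.exp_le_exp.2 (neg_le_neg ?_)) (Real.exp_pos _).le (by positivity)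
      have hw : ‖ξ‖ / (2 * h) ≤ ‖(1 / h) • ξ + (2 * Real.pi) • k‖ := by
        have h1 : ‖(1 / h) • ξ‖ = ‖ξ‖ / h := by
          rw [norm_smul, Real.norm_of_nonneg (by positivity)]; ring
        have h2 : ‖(2 * Real.pi) • k‖ ≤ 2 * Real.pi * R := by
          rw [norm_smul, Real.norm_of_nonneg (by positivity)]
          exact mul_le_mul_of_nonneg_left (hR k hk) (by positivity)
        have h3 : 2 * Real.pi * R ≤ ‖ξ‖ / (2 * h) := by
          rw [le_div_iff₀ (by positivity)]; nlinarith
        have h4 : ‖(1 / h) • ξ‖ ≤ ‖(1 / h) • ξ + (2 * Real.pi) • k‖ + ‖(2 * Real.pi) • k‖ := by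
          simpa using norm_sub_le ((1 / h) • ξ + (2 * Real.pi) • k) ((2 * Real.pi) • k)
        have h5 : ‖ξ‖ / h = ‖ξ‖ / (2 * h) + ‖ξ‖ / (2 * h) := by field_simp; ring
        linarith
      calc ‖ξ‖ ^ 2 / (8 * h) = h / 2 * (‖ξ‖ / (2 * h)) ^ 2 := by field_simp; ring
        _ ≤ _ := by gcongr
    refine (MeasureTheory.norm_integral_le_of_norm_le (u.integrable.norm.const_mul _)
      (Eventually.of_forall hb)).trans (le_of_eq ?_)
    rw [MeasureTheory.integral_const_mul]
    ring
  have hfbi : ‖fbi h (𝓕 u) x ξ‖ ≤ (h ^ n)⁻¹ * (A * Real.exp (-(‖ξ‖ ^ 2 / (8 * h)))) := by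
    rw [fbi_eq_integral_wavePacket, norm_mul]
    exact mul_le_mul (norm_fbi_prefactor_le hh0 hle1) hint (norm_nonneg _) (by positivity)
  -- One half of the exponent becomes a Gaussian in `ξ`, which beats the polynomial weight; the
  -- other half gives smallness in `h`.
  have hexp : Real.exp (-(‖ξ‖ ^ 2 / (8 * h))) ≤
      Real.exp (-(‖ξ‖ ^ 2 / 16)) * Real.exp (-(ε ^ 2 / 16) / h) := by
    rw [← Real.exp_add]
    refine Real.exp_le_exp.2 ?_
    have h1 : ‖ξ‖ ^ 2 / 16 ≤ ‖ξ‖ ^ 2 / (16 * h) := by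
      gcongr
      linarith
    have h2 : ε ^ 2 / (16 * h) ≤ ‖ξ‖ ^ 2 / (16 * h) := by gcongr
    have h3 : ‖ξ‖ ^ 2 / (8 * h) = ‖ξ‖ ^ 2 / (16 * h) + ‖ξ‖ ^ 2 / (16 * h) := by field_simp; ring
    have h4 : -(ε ^ 2 / 16) / h = -(ε ^ 2 / (16 * h)) := by field_simp
    rw [h3, h4]
    linarith
  have hpoly : (1 + ‖ξ‖ ^ 2) ^ N * Real.exp (-(‖ξ‖ ^ 2 / 16)) ≤
      16 ^ N * (N.factorial * Real.exp 1) := by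
    have h1 := one_add_pow_le_factorial_mul_exp N (t := ‖ξ‖ ^ 2 / 16) (by positivity)
    have h2 : (1 + ‖ξ‖ ^ 2) ^ N ≤ (16 * (1 + ‖ξ‖ ^ 2 / 16)) ^ N := by
      gcongr
      linarith
    rw [mul_pow] at h2
    calc (1 + ‖ξ‖ ^ 2) ^ N * Real.exp (-(‖ξ‖ ^ 2 / 16))
        ≤ (16 ^ N * (N.factorial * Real.exp 1 * Real.exp (‖ξ‖ ^ 2 / 16))) *
            Real.exp (-(‖ξ‖ ^ 2 / 16)) := by
          gcongr
          exact h2.trans (by gcongr)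
      _ = 16 ^ N * (N.factorial * Real.exp 1) *
            (Real.exp (‖ξ‖ ^ 2 / 16) * Real.exp (-(‖ξ‖ ^ 2 / 16))) := by ring
      _ = _ := by rw [← Real.exp_add, add_neg_cancel, Real.exp_zero, mul_one]
  calc (1 + ‖ξ‖ ^ 2) ^ N * ‖fbi h (𝓕 u) x ξ‖
      ≤ (1 + ‖ξ‖ ^ 2) ^ N * ((h ^ n)⁻¹ * (A *
          (Real.exp (-(‖ξ‖ ^ 2 / 16)) * Real.exp (-(ε ^ 2 / 16) / h)))) := by
        gcongr
        exact hfbi.trans (by gcongr)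
    _ = ((1 + ‖ξ‖ ^ 2) ^ N * Real.exp (-(‖ξ‖ ^ 2 / 16))) * A *
          ((h ^ n)⁻¹ * Real.exp (-(ε ^ 2 / 16) / h)) := by ring
    _ ≤ _ := by gcongr

/-- Decay in `x` of the FBI transform of a Schwartz function. -/
lemma exists_norm_fbi_le (f : 𝓢(Euc n, ℂ)) (N : ℕ) : ∃ C, 0 ≤ C ∧ ∀ h : ℝ, 0 < h → h ≤ 1 →
    ∀ x ξ : Euc n, (1 + ‖x‖ ^ 2) ^ N * ‖fbi h f x ξ‖ ≤ C * (h ^ n)⁻¹ := by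
  have hI : MeasureTheory.Integrable (fun y : Euc n => (1 + ‖y‖ ^ (2 * N)) * ‖f y‖) := by
    have := f.integrable.norm.add (f.integrable_pow_mul MeasureTheory.volume (2 * N))
    refine this.congr (Eventually.of_forall fun y => ?_)
    simp only [Pi.add_apply]
    ring
  let B : ℝ := 4 ^ N * (N.factorial * Real.exp 1) * 2 ^ (N - 1)
  have hB : 0 ≤ B := by positivity
  refine ⟨B * ∫ y : Euc n, (1 + ‖y‖ ^ (2 * N)) * ‖f y‖, mul_nonneg hB
    (MeasureTheory.integral_nonneg fun _ => by positivity), fun h hh h1 x ξ => ?_⟩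
  have hb : ∀ y, ‖((1 + ‖x‖ ^ 2) ^ N : ℝ) • (wavePacket h ξ (x - y) * f y)‖ ≤
      B * ((1 + ‖y‖ ^ (2 * N)) * ‖f y‖) := by
    intro y
    rw [norm_smul, norm_mul, Real.norm_of_nonneg (by positivity), norm_wavePacket]
    -- A Peetre-type inequality: the weight in `x` is shared between the Gaussian in `x - y` and the
    -- decay of `f`.
    have hxy : 1 + ‖x‖ ^ 2 ≤ 4 * (1 + ‖x - y‖ ^ 2 / 2) * (1 + ‖y‖ ^ 2) := by
      have h2 : ‖x‖ ≤ ‖x - y‖ + ‖y‖ := by simpa using norm_add_le (x - y) y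
      have h3 : ‖x‖ ^ 2 ≤ (‖x - y‖ + ‖y‖) ^ 2 := by gcongr
      nlinarith [sq_nonneg (‖x - y‖ - ‖y‖), mul_nonneg (sq_nonneg ‖x - y‖) (sq_nonneg ‖y‖),
        sq_nonneg ‖y‖, sq_nonneg ‖x - y‖]
    have hg : Real.exp (-(‖x - y‖ ^ 2 / (2 * h))) ≤ Real.exp (-(‖x - y‖ ^ 2 / 2)) := by
      refine Real.exp_le_exp.2 (neg_le_neg ?_)
      gcongr
      linarith
    have hp := one_add_pow_le_factorial_mul_exp N (t := ‖x - y‖ ^ 2 / 2) (by positivity)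
    have hq : (1 + ‖y‖ ^ 2) ^ N ≤ 2 ^ (N - 1) * (1 + ‖y‖ ^ (2 * N)) := by
      have := add_pow_le (zero_le_one (α := ℝ)) (sq_nonneg ‖y‖) N
      rwa [one_pow, ← pow_mul] at this
    calc (1 + ‖x‖ ^ 2) ^ N * (Real.exp (-(‖x - y‖ ^ 2 / (2 * h))) * ‖f y‖)
        ≤ (4 * (1 + ‖x - y‖ ^ 2 / 2) * (1 + ‖y‖ ^ 2)) ^ N *
            (Real.exp (-(‖x - y‖ ^ 2 / 2)) * ‖f y‖) := by gcongr
      _ = 4 ^ N * (1 + ‖x - y‖ ^ 2 / 2) ^ N * (1 + ‖y‖ ^ 2) ^ N *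
            (Real.exp (-(‖x - y‖ ^ 2 / 2)) * ‖f y‖) := by rw [mul_pow, mul_pow]
      _ ≤ 4 ^ N * (N.factorial * Real.exp 1 * Real.exp (‖x - y‖ ^ 2 / 2)) *
            (2 ^ (N - 1) * (1 + ‖y‖ ^ (2 * N))) *
            (Real.exp (-(‖x - y‖ ^ 2 / 2)) * ‖f y‖) := by gcongr
      _ = B * ((1 + ‖y‖ ^ (2 * N)) * ‖f y‖) *
            (Real.exp (‖x - y‖ ^ 2 / 2) * Real.exp (-(‖x - y‖ ^ 2 / 2))) := by ring
      _ = _ := by rw [← Real.exp_add, add_neg_cancel, Real.exp_zero, mul_one]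
  have hint := MeasureTheory.norm_integral_le_of_norm_le (hI.const_mul B) (Eventually.of_forall hb)
  rw [MeasureTheory.integral_smul, norm_smul, Real.norm_of_nonneg (by positivity),
    MeasureTheory.integral_const_mul] at hint
  rw [fbi_eq_integral_wavePacket, norm_mul, mul_left_comm, mul_comm _ (h ^ n)⁻¹]
  exact mul_le_mul (norm_fbi_prefactor_le hh h1) hint (by positivity) (by positivity)

lemma lt_norm_snd_of_lt_infEDist {p : Euc n × Euc n} {ε : ℝ} (hε : 0 ≤ ε)
    (hp : ENNReal.ofReal ε < Metric.infEDist p {p | p.2 = 0}) : ε < ‖p.2‖ := by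
  have h1 : Metric.infEDist p {p : Euc n × Euc n | p.2 = 0} ≤ edist p (p.1, 0) :=
    Metric.infEDist_le_edist_of_mem rfl
  have h2 := hp.trans_le h1
  rw [edist_dist, ENNReal.ofReal_lt_ofReal_iff_of_nonneg hε, Prod.dist_eq] at h2
  simpa [hε] using h2

/-- The constant family given by the Fourier transform of a compactly supported function is
uniformly microsupported in the zero section. -/
theorem zeroEnergy_fourier (u : 𝓢(Euc n, ℂ)) (hu : HasCompactSupport u) :
    ZeroEnergy fun _ : ℝ => 𝓕 u := by
  refine ⟨fun k l => ⟨0, ?_⟩, fun ε hε => ⟨ε ^ 2 / 64, by positivity, fun N => ?_⟩⟩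
  · simp only [pow_zero, inv_one]
    exact isBigO_const_const _ one_ne_zero _
  -- The joint weight comes from the geometric mean of the decay in `ξ` and the decay in `x`, hence
  -- the exponent `2 * N`. The square root turns `ε²/16` into `ε²/32`, and absorbing `h⁻ⁿ` leaves
  -- `ε²/64`.
  obtain ⟨C₁, hC₁, h₁⟩ := exists_norm_fbi_fourier_le u hu hε (2 * N)
  obtain ⟨C₂, hC₂, h₂⟩ := exists_norm_fbi_le (𝓕 u) (2 * N)
  refine ⟨Real.sqrt (C₁ * C₂) * (n.factorial * ((ε ^ 2 / 64) ^ n)⁻¹), ?_⟩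
  filter_upwards [h₁, Ioo_mem_nhdsGT one_pos] with h h₁ hh p hp
  have hξ := lt_norm_snd_of_lt_infEDist hε.le hp
  have b₁ := h₁ p.1 p.2 hξ
  have b₂ := h₂ h hh.1 hh.2.le p.1 p.2
  set T := ‖fbi h (𝓕 u) p.1 p.2‖
  have hT : 0 ≤ T := norm_nonneg _
  have hw : 1 + ‖p.1‖ ^ 2 + ‖p.2‖ ^ 2 ≤ (1 + ‖p.1‖ ^ 2) * (1 + ‖p.2‖ ^ 2) := by
    nlinarith [mul_nonneg (sq_nonneg ‖p.1‖) (sq_nonneg ‖p.2‖)]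
  have hhn : 0 < (h ^ n)⁻¹ := inv_pos.2 (pow_pos hh.1 n)
  have hsq : ((1 + ‖p.1‖ ^ 2 + ‖p.2‖ ^ 2) ^ N * T) ^ 2 ≤
      (Real.sqrt (C₁ * C₂) * ((h ^ n)⁻¹ * Real.exp (-(2 * (ε ^ 2 / 64)) / h))) ^ 2 := by
    calc ((1 + ‖p.1‖ ^ 2 + ‖p.2‖ ^ 2) ^ N * T) ^ 2
        ≤ (((1 + ‖p.1‖ ^ 2) * (1 + ‖p.2‖ ^ 2)) ^ N * T) ^ 2 := by gcongr
      _ = ((1 + ‖p.2‖ ^ 2) ^ (2 * N) * T) * ((1 + ‖p.1‖ ^ 2) ^ (2 * N) * T) := by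
        simp only [mul_pow]; ring
      _ ≤ (C₁ * ((h ^ n)⁻¹ * Real.exp (-(ε ^ 2 / 16) / h))) * (C₂ * (h ^ n)⁻¹) := by gcongr
      _ = (C₁ * C₂) * (h ^ n)⁻¹ ^ 2 * Real.exp (-(ε ^ 2 / 16) / h) := by ring
      _ = _ := by
        rw [mul_pow, Real.sq_sqrt (by positivity), mul_pow, ← Real.exp_nat_mul, mul_assoc]
        congr 3
        push_cast
        ring
  have hfin := (le_abs_self _).trans (abs_le_of_sq_le_sq hsq (by positivity))
  refine hfin.trans ?_
  rw [mul_assoc]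
  exact mul_le_mul_of_nonneg_left (inv_pow_mul_exp_neg_le n (by positivity) hh.1)
    (Real.sqrt_nonneg _)

end TemperedQFT

end

/-! ### Restriction to and extension from the embedded manifold -/

noncomputable section

namespace TemperedQFT

variable {d n : ℕ} {M : Type*} [TopologicalSpace M] [ChartedSpace (Euc d) M] {ι : M → Euc n}

lemma IsProperAnalyticEmbedding.isClosedEmbedding (hι : IsProperAnalyticEmbedding (d := d) ι) :
    IsClosedEmbedding ι :=
  ⟨hι.embedding.isEmbedding, hι.proper.isClosedMap.isClosed_range⟩

/-- Properness makes `ι` a closed embedding, so compact supports pull back to compact supports. -/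
lemma pullback_mem_testFunctions (hι : IsProperAnalyticEmbedding (d := d) ι) (F : 𝓢(Euc n, ℂ))
    (hF : HasCompactSupport F) : pullback ι F ∈ testFunctions d M := by
  refine ⟨?_, hF.comp_isClosedEmbedding hι.isClosedEmbedding⟩
  have h1 : ContMDiff (𝓡 d) 𝓘(ℝ, Euc n) ∞ ι :=
    hι.embedding.isImmersion.contMDiff.of_le (by exact_mod_cast le_top)
  exact (F.smooth ⊤).contMDiff.comp h1

/-- Smooth functions on an embedded submanifold extend locally to the ambient space. -/
lemma exists_local_extension (hι : IsProperAnalyticEmbedding (d := d) ι) {f : M → ℂ}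
    (hf : ContMDiff (𝓡 d) 𝓘(ℝ, ℂ) ∞ f) (x : M) :
    ∃ U ∈ 𝓝 (ι x), ∃ g : Euc n → ℂ, ContMDiffOn 𝓘(ℝ, Euc n) 𝓘(ℝ, ℂ) ∞ g U ∧
      ∀ y ∈ U, ∀ x', ι x' = y → g y = f x' := by
  have im := hι.embedding.isImmersion.isImmersionAt x
  let pr : Euc n → Euc d := fun v => (im.equiv.symm v).1
  have hpr : ContDiff ℝ ∞ pr := contDiff_fst.comp im.equiv.symm.contDiff
  have hloc : ∀ x' ∈ im.domChart.source, pr (im.codChart (ι x')) = im.domChart x' := by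
    intro x' hx'
    have ht : im.domChart x' ∈ (im.domChart.extend (𝓡 d)).target := by
      simpa using im.domChart.map_source hx'
    have h := im.writtenInCharts ht
    have h' : im.codChart (ι (im.domChart.symm (im.domChart x'))) = im.equiv (im.domChart x', 0) :=
      h
    rw [im.domChart.left_inv hx'] at h'
    simp only [pr]
    rw [h', ContinuousLinearEquiv.symm_apply_apply]
  -- Since `ι` is a topological embedding, `V` excludes points of `ι(M)` from outside the chart, so
  -- the extension, constant along the normal coordinates, agrees with `f` on all of `ι(M) ∩ V`.
  obtain ⟨V, hV, hVι⟩ := hι.embedding.isEmbedding.isInducing.isOpen_iff.1 im.domChart.open_source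
  have hcont : ContinuousOn (fun y => pr (im.codChart y)) im.codChart.source :=
    hpr.continuous.comp_continuousOn im.codChart.continuousOn
  have hW : IsOpen (im.codChart.source ∩ (fun y => pr (im.codChart y)) ⁻¹' im.domChart.target) :=
    hcont.isOpen_inter_preimage im.codChart.open_source im.domChart.open_target
  have hxV : ι x ∈ V := by
    change x ∈ ι ⁻¹' V
    rw [hVι]
    exact im.mem_domChart_source
  refine ⟨(im.codChart.source ∩ (fun y => pr (im.codChart y)) ⁻¹' im.domChart.target) ∩ V,
    (hW.inter hV).mem_nhds ⟨⟨im.mem_codChart_source, ?_⟩, hxV⟩,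
    fun y => f (im.domChart.symm (pr (im.codChart y))), ?_, ?_⟩
  · change pr (im.codChart (ι x)) ∈ im.domChart.target
    rw [hloc x im.mem_domChart_source]
    exact im.domChart.map_source im.mem_domChart_source
  · have h1 : ContMDiffOn 𝓘(ℝ, Euc n) 𝓘(ℝ, Euc n) ∞ im.codChart im.codChart.source :=
      (contMDiffOn_of_mem_maximalAtlas im.codChart_mem_maximalAtlas).of_le
        (by exact_mod_cast le_top)
    have h2 : ContMDiffOn (𝓡 d) (𝓡 d) ∞ im.domChart.symm im.domChart.target :=
      (contMDiffOn_symm_of_mem_maximalAtlas im.domChart_mem_maximalAtlas).of_le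
        (by exact_mod_cast le_top)
    have h3 : ContMDiffOn 𝓘(ℝ, Euc n) (𝓡 d) ∞ (fun y => pr (im.codChart y))
        im.codChart.source := hpr.contMDiff.comp_contMDiffOn h1
    exact hf.comp_contMDiffOn ((h2.comp (h3.mono Set.inter_subset_left) fun y hy => hy.2).mono
      Set.inter_subset_left)
  · rintro y ⟨_, hyV⟩ x' rfl
    have hx' : x' ∈ im.domChart.source := by
      rw [← hVι]
      exact hyV
    simp only
    rw [hloc x' hx', im.domChart.left_inv hx']

/-- Every test function on `M` is the restriction of a Schwartz function. -/
lemma exists_pullback_eq (hι : IsProperAnalyticEmbedding (d := d) ι) (f : testFunctions d M) :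
    ∃ F : 𝓢(Euc n, ℂ), pullback ι F = f := by
  obtain ⟨f, hf, hfc⟩ := f
  -- Partition of unity gluing: the admissible values are the single value of `f` on `ι(M)` and all
  -- of `ℂ` off it, a convex condition.
  obtain ⟨G, hG⟩ := exists_contMDiffMap_forall_mem_convex_of_local (n := ⊤) 𝓘(ℝ, Euc n)
    (t := fun y => {z : ℂ | ∀ x', ι x' = y → z = f x'})
    (fun y a ha b hb s t _ _ hst x' hx' => by
      rw [ha x' hx', hb x' hx', ← add_smul, hst, one_smul])
    (fun y => by
      by_cases hy : y ∈ Set.range ι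
      · obtain ⟨x, rfl⟩ := hy
        exact exists_local_extension hι hf x
      · exact ⟨(Set.range ι)ᶜ, hι.isClosedEmbedding.isClosed_range.isOpen_compl.mem_nhds hy,
          fun _ => 0, contMDiffOn_const, fun y hy x' hx' => (hy ⟨x', hx'⟩).elim⟩)
  have hGf : ∀ x, G (ι x) = f x := fun x => hG (ι x) x rfl
  obtain ⟨R, hR⟩ := (hfc.isCompact.image hι.isClosedEmbedding.continuous).isBounded.exists_norm_le
  let χ : ContDiffBump (0 : Euc n) :=
    ⟨max R 1, max R 1 + 1, by positivity, by linarith⟩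
  have hs : HasCompactSupport fun y => ((χ y : ℝ) : ℂ) * G y :=
    (χ.hasCompactSupport.comp_left (g := fun r : ℝ => (r : ℂ)) Complex.ofReal_zero).mul_right
  have hd : ContDiff ℝ ∞ fun y => ((χ y : ℝ) : ℂ) * G y :=
    (Complex.ofRealCLM.contDiff.comp χ.contDiff).mul G.contMDiff.contDiff
  refine ⟨hs.toSchwartzMap hd, funext fun x => ?_⟩
  change ((χ (ι x) : ℝ) : ℂ) * G (ι x) = f x
  rw [hGf]
  by_cases hx : f x = 0
  · rw [hx, mul_zero]
  · rw [χ.one_of_mem_closedBall, Complex.ofReal_one, one_mul]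
    rw [mem_closedBall_zero_iff]
    exact (hR _ ⟨x, subset_tsupport _ hx, rfl⟩).trans (le_max_left _ _)

end TemperedQFT

end

/-! ### Hermiticity and continuity of products of fields -/

noncomputable section

namespace TemperedQFT

variable {d n : ℕ} {M : Type*} [TopologicalSpace M] [ChartedSpace (Euc d) M]
  {H : Type*} [NormedAddCommGroup H] [InnerProductSpace ℂ H] {Q : QuantumField d M H} {ι : M → Euc n}

/-- Complex conjugation of Schwartz functions. -/
def conjSchwartz : 𝓢(Euc n, ℂ) →L[ℝ] 𝓢(Euc n, ℂ) :=
  SchwartzMap.postcompCLM (Complex.conjCLE : ℂ →L[ℝ] ℂ)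

lemma conjSchwartz_apply (F : 𝓢(Euc n, ℂ)) (y : Euc n) :
    conjSchwartz F y = starRingEnd ℂ (F y) := rfl

namespace TemperedExtension

lemma prod_cons (E : TemperedExtension Q ι) (g : SchwartzOn ι) (l : List (SchwartzOn ι)) :
    E.prod (g :: l) = E.Φ g * E.prod l := by
  simp [TemperedExtension.prod]

lemma prod_append (E : TemperedExtension Q ι) (l l' : List (SchwartzOn ι)) :
    E.prod (l ++ l') = E.prod l * E.prod l' := by
  simp [TemperedExtension.prod]

lemma continuous_restrict (E : TemperedExtension Q ι) (v : Q.D) :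
    Continuous fun F : 𝓢(Euc n, ℂ) => (E.Φ (restrict ι F) v : H) :=
  (E.continuous v).comp continuous_quot_mk

lemma inner_of_real (E : TemperedExtension Q ι) (hι : IsProperAnalyticEmbedding (d := d) ι)
    (F : 𝓢(Euc n, ℂ)) (hF : HasCompactSupport F) (hr : ∀ y, starRingEnd ℂ (F y) = F y)
    (v w : Q.D) :
    ⟪(E.Φ (restrict ι F) v : H), (w : H)⟫_ℂ = ⟪(v : H), (E.Φ (restrict ι F) w : H)⟫_ℂ := by
  rw [E.extends_field ⟨pullback ι F, pullback_mem_testFunctions hι F hF⟩ F rfl]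
  exact Q.symmetric _ (fun x => hr (ι x)) v w

/-- The hermiticity relation `Φ(F)* ⊇ Φ(F̄)` holds for all Schwartz functions. -/
lemma inner_conj (E : TemperedExtension Q ι) (hι : IsProperAnalyticEmbedding (d := d) ι)
    (F : 𝓢(Euc n, ℂ)) (v w : Q.D) :
    ⟪(E.Φ (restrict ι F) v : H), (w : H)⟫_ℂ =
      ⟪(v : H), (E.Φ (restrict ι (conjSchwartz F)) w : H)⟫_ℂ := by
  have hclosed : IsClosed {F : 𝓢(Euc n, ℂ) | ⟪(E.Φ (restrict ι F) v : H), (w : H)⟫_ℂ =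
      ⟪(v : H), (E.Φ (restrict ι (conjSchwartz F)) w : H)⟫_ℂ} :=
    isClosed_eq ((E.continuous_restrict v).inner continuous_const)
      (continuous_const.inner ((E.continuous_restrict w).comp conjSchwartz.continuous))
  refine hclosed.closure_subset_iff.2 ?_ (SchwartzMap.dense_hasCompactSupport F)
  intro F hF
  -- `A` and `B` are the real and imaginary parts of `F`; both keep compact support, so the assumed
  -- symmetry applies to each.
  let A : 𝓢(Euc n, ℂ) := (1 / 2 : ℂ) • (F + conjSchwartz F)
  let B : 𝓢(Euc n, ℂ) := (-Complex.I / 2 : ℂ) • (F - conjSchwartz F)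
  have hc : HasCompactSupport (conjSchwartz F) :=
    HasCompactSupport.comp_left (g := starRingEnd ℂ) hF (map_zero _)
  have hA : HasCompactSupport A := (HasCompactSupport.add hF hc).smul_left (f := fun _ => (1 / 2 : ℂ))
  have hB : HasCompactSupport B :=
    (HasCompactSupport.sub hF hc).smul_left (f := fun _ => (-Complex.I / 2 : ℂ))
  have hA' := E.inner_of_real hι A hA (fun y => by
    simp only [A, _root_.smul_apply, _root_.add_apply, conjSchwartz_apply, smul_eq_mul,
      map_mul, map_add, Complex.conj_conj, map_div₀, map_one, Complex.conj_ofNat]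
    ring) v w
  have hB' := E.inner_of_real hι B hB (fun y => by
    simp only [B, _root_.smul_apply, _root_.sub_apply, conjSchwartz_apply, smul_eq_mul,
      map_mul, map_sub, Complex.conj_conj, map_div₀, map_neg, Complex.conj_I, Complex.conj_ofNat]
    ring) v w
  have hF₁ : F = A + Complex.I • B := by
    ext y
    simp only [A, B, _root_.smul_apply, _root_.add_apply, _root_.sub_apply,
      smul_eq_mul]
    linear_combination (1 / 2 * (F y - conjSchwartz F y)) * Complex.I_sq
  have hF₂ : conjSchwartz F = A - Complex.I • B := by
    ext y
    simp only [A, B, _root_.smul_apply, _root_.add_apply, _root_.sub_apply,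
      smul_eq_mul]
    linear_combination (-1 / 2 * (F y - conjSchwartz F y)) * Complex.I_sq
  change ⟪(E.Φ (restrict ι F) v : H), (w : H)⟫_ℂ =
      ⟪(v : H), (E.Φ (restrict ι (conjSchwartz F)) w : H)⟫_ℂ
  rw [hF₂]
  nth_rewrite 1 [hF₁]
  simp only [map_add, map_sub, map_smul, LinearMap.add_apply, LinearMap.sub_apply,
    LinearMap.smul_apply, Submodule.coe_add, Submodule.coe_sub, Submodule.coe_smul,
    inner_add_left, inner_sub_right, inner_smul_left, inner_smul_right, Complex.conj_I, hA', hB']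
  ring

/-- Factors are moved across one at a time by `inner_conj`. Only the pairing identity is needed
later, so `B` is a bare function. -/
lemma exists_adjoint_prod (E : TemperedExtension Q ι) (hι : IsProperAnalyticEmbedding (d := d) ι)
    (l : List (SchwartzOn ι)) :
    ∃ B : Q.D → Q.D, ∀ v w : Q.D, ⟪(E.prod l v : H), (w : H)⟫_ℂ = ⟪(v : H), (B w : H)⟫_ℂ := by
  induction l with
  | nil => exact ⟨id, fun v w => by simp [TemperedExtension.prod]⟩
  | cons g l ih =>
    obtain ⟨B, hB⟩ := ih
    obtain ⟨F, rfl⟩ := Submodule.mkQ_surjective _ g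
    refine ⟨fun w => B (E.Φ (restrict ι (conjSchwartz F)) w), fun v w => ?_⟩
    rw [prod_cons, Module.End.mul_apply, ← hB]
    exact E.inner_conj hι F _ w

/-- The vector-valued map `F ↦ Φ(g₁) ⋯ Φ(g_m) Φ(F) v` is continuous. -/
lemma continuous_prod_apply (E : TemperedExtension Q ι)
    (hι : IsProperAnalyticEmbedding (d := d) ι) (l : List (SchwartzOn ι)) (v : Q.D) :
    Continuous fun F : 𝓢(Euc n, ℂ) => (E.prod l (E.Φ (restrict ι F) v) : H) := by
  obtain ⟨B, hB⟩ := E.exists_adjoint_prod hι l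
  let L : 𝓢(Euc n, ℂ) →ₗ[ℂ] H :=
    Q.D.subtype ∘ₗ E.prod l ∘ₗ LinearMap.applyₗ v ∘ₗ E.Φ ∘ₗ restrict ι
  have hL : ∀ F, L F = (E.prod l (E.Φ (restrict ι F) v) : H) := fun F => rfl
  let p : Seminorm ℂ 𝓢(Euc n, ℂ) := (normSeminorm ℂ H).comp L
  have hp : ∀ F, p F = ‖L F‖ := fun F => rfl
  have hlsc : LowerSemicontinuous p := by
    rw [lowerSemicontinuous_iff_isClosed_preimage]
    intro c
    rcases lt_or_ge c 0 with hc | hc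
    · have : p ⁻¹' Set.Iic c = ∅ := by
        ext F
        simpa using hc.trans_le (apply_nonneg p F)
      rw [this]
      exact isClosed_empty
    -- The vector lies in `Q.D`, so its norm is detected by pairing with `w` in `Q.D`, in particular
    -- with itself. Through `B` each pairing is continuous in `F`.
    · have : p ⁻¹' Set.Iic c = ⋂ w : Q.D,
          {F | ‖⟪(E.Φ (restrict ι F) v : H), (B w : H)⟫_ℂ‖ ≤ c * ‖(w : H)‖} := by
        ext F
        simp only [Set.mem_preimage, Set.mem_Iic, Set.mem_iInter, Set.mem_ofPred_eq, hp, ← hB, hL]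
        constructor
        · intro h w
          exact (norm_inner_le_norm _ _).trans (by gcongr)
        · intro h
          have h1 := h (E.prod l (E.Φ (restrict ι F) v))
          rw [inner_self_eq_norm_sq_to_K] at h1
          simp only [norm_pow, Complex.coe_algebraMap, Complex.norm_real, norm_norm] at h1
          by_contra! hlt
          nlinarith
      rw [this]
      exact isClosed_iInter fun w => isClosed_le
        ((E.continuous_restrict v).inner continuous_const).norm continuous_const
  -- Barrelledness of the Schwartz space enters here.
  have hpc : Continuous p := Seminorm.continuous_of_lowerSemicontinuous p hlsc
  refine continuous_of_continuousAt_zero L ?_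
  rw [ContinuousAt, map_zero, tendsto_zero_iff_norm_tendsto_zero]
  have h := hpc.tendsto 0
  rw [map_zero] at h
  exact h

lemma exists_list_prod_eq (E : TemperedExtension Q ι)
    (hι : IsProperAnalyticEmbedding (d := d) ι) (l : List (Module.End ℂ Q.D)) (hl : ∀ A ∈ l, A ∈ Set.range Q.Φ) :
    ∃ g : List (SchwartzOn ι), E.prod g = l.prod := by
  induction l with
  | nil => exact ⟨[], rfl⟩
  | cons A l ih =>
    obtain ⟨g, hg⟩ := ih fun B hB => hl B (List.mem_cons_of_mem _ hB)
    obtain ⟨f, rfl⟩ := hl A List.mem_cons_self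
    obtain ⟨F, hF⟩ := exists_pullback_eq hι f
    exact ⟨restrict ι F :: g, by
      rw [TemperedExtension.prod_cons, E.extends_field f F hF, hg, List.prod_cons]⟩

end TemperedExtension

lemma isBigO_exp_neg_div_of_le {δ δ' : ℝ} (h : δ ≤ δ') :
    (fun t : ℝ => Real.exp (-δ' / t)) =O[𝓝[>] (0 : ℝ)] fun t => Real.exp (-δ / t) := by
  refine IsBigO.of_bound 1 ?_
  filter_upwards [self_mem_nhdsWithin] with t ht
  rw [Real.norm_of_nonneg (Real.exp_pos _).le, Real.norm_of_nonneg (Real.exp_pos _).le, one_mul]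
  have : 0 < t := ht
  gcongr

/-! ### Tempered analytic vectors and their density -/

section TemperedAnalytic

variable [IsManifold (𝓡 d) ω M] {S : Spacetime d M} {E : TemperedExtension Q ι}

variable (S E) in
/-- The subspace of tempered analytic vectors. -/
def temperedAnalyticSubmodule : Submodule ℂ Q.D where
  carrier := {φ | IsTemperedAnalytic S E φ}
  zero_mem' := fun K _ _ f _ q _ => ⟨1, one_pos, by simpa using isBigO_zero _ _⟩
  add_mem' := by
    intro φ ψ hφ hψ K hK hKV f hf q hq
    obtain ⟨δ₁, hδ₁, h₁⟩ := hφ K hK hKV f hf q hq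
    obtain ⟨δ₂, hδ₂, h₂⟩ := hψ K hK hKV f hf q hq
    refine ⟨min δ₁ δ₂, lt_min hδ₁ hδ₂, ?_⟩
    simp only [map_add, Submodule.coe_add]
    exact ((isBigO_norm_left.1 (h₁.trans (isBigO_exp_neg_div_of_le (min_le_left _ _)))).add
      (isBigO_norm_left.1 (h₂.trans (isBigO_exp_neg_div_of_le (min_le_right _ _))))).norm_left
  smul_mem' := by
    intro c φ hφ K hK hKV f hf q hq
    obtain ⟨δ, hδ, h⟩ := hφ K hK hKV f hf q hq
    refine ⟨δ, hδ, ?_⟩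
    simp only [map_smul, Submodule.coe_smul]
    exact ((isBigO_norm_left.1 h).const_smul_left c).norm_left

/-- Products of fields smeared with analytic Schwartz functions preserve tempered analyticity. -/
lemma IsTemperedAnalytic.prod_apply {Ω : Q.D} (hΩ : IsTemperedAnalytic S E Ω)
    (g : List (SchwartzOn ι)) (hg : ∀ u ∈ g, u ∈ analyticSchwartz ι) :
    IsTemperedAnalytic S E (E.prod g Ω) := by
  intro K hK hKV f hf q hq
  -- The fixed functions `g` join the insertions as constant families.
  obtain ⟨δ, hδ, h⟩ := hΩ K hK hKV f hf (q ++ g.map fun u _ => u) (by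
    intro p hp
    rcases List.mem_append.1 hp with hp | hp
    · exact hq p hp
    · obtain ⟨u, hu, rfl⟩ := List.mem_map.1 hp
      obtain ⟨w, hw, rfl⟩ := hg u hu
      exact ⟨fun _ => 𝓕 w, zeroEnergy_fourier w hw, fun _ => rfl⟩)
  refine ⟨δ, hδ, ?_⟩
  simpa [TemperedExtension.prod_append, Function.comp_def] using h

/-- Vectors `Φ(g₁) ⋯ Φ(g_m) Ω` with Schwartz functions `g_i` are limits of tempered analytic
vectors. -/
lemma prod_apply_mem_closure (hι : IsProperAnalyticEmbedding (d := d) ι) {Ω : Q.D}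
    (hΩ : IsTemperedAnalytic S E Ω) (l : List (SchwartzOn ι)) :
    ∀ g : List (SchwartzOn ι), (∀ u ∈ g, u ∈ analyticSchwartz ι) →
      -- The induction peels off the last factor of `l`: once approximated by an analytic one it
      -- joins `g`, which must therefore be arbitrary.
      (E.prod l (E.prod g Ω) : H) ∈
        ((temperedAnalyticSubmodule S E).map Q.D.subtype).topologicalClosure := by
  induction l using List.reverseRecOn with
  | nil =>
    intro g hg
    refine Submodule.le_topologicalClosure _ ⟨E.prod g Ω, hΩ.prod_apply g hg, ?_⟩
    simp [TemperedExtension.prod]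
  | append_singleton l a ih =>
    intro g hg
    obtain ⟨F, rfl⟩ := Submodule.mkQ_surjective _ a
    have hclosed := (Submodule.isClosed_topologicalClosure
      ((temperedAnalyticSubmodule S E).map Q.D.subtype)).preimage
      (E.continuous_prod_apply hι l (E.prod g Ω))
    have hmem := closure_minimal (s := {f : 𝓢(Euc n, ℂ) | ∃ u : 𝓢(Euc n, ℂ),
      HasCompactSupport u ∧ f = 𝓕 u}) (by
        rintro _ ⟨u, hu, rfl⟩
        have := ih (restrict ι (𝓕 u) :: g) (by
          intro w hw
          rcases List.mem_cons.1 hw with rfl | hw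
          · exact ⟨u, hu, rfl⟩
          · exact hg w hw)
        rwa [TemperedExtension.prod_cons] at this) hclosed
      (SchwartzMap.dense_fourier_hasCompactSupport F)
    rw [TemperedExtension.prod_append]
    simpa [TemperedExtension.prod] using! hmem

/-- If `Ω` is cyclic and tempered analytic, the tempered analytic vectors are dense. -/
lemma dense_isTemperedAnalytic (hι : IsProperAnalyticEmbedding (d := d) ι) {Ω : Q.D}
    (hΩ : IsTemperedAnalytic S E Ω) (hc : Q.IsCyclic Ω) :
    Dense {v : H | ∃ φ : Q.D, IsTemperedAnalytic S E φ ∧ v = φ} := by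
  have hset : {v : H | ∃ φ : Q.D, IsTemperedAnalytic S E φ ∧ v = φ} =
      ((temperedAnalyticSubmodule S E).map Q.D.subtype : Submodule ℂ H) := by
    ext v
    constructor
    · rintro ⟨φ, hφ, rfl⟩
      exact ⟨φ, hφ, rfl⟩
    · rintro ⟨φ, hφ, rfl⟩
      exact ⟨φ, hφ, rfl⟩
  rw [hset, ← dense_closure]
  refine hc.mono ?_
  rintro _ ⟨A, hA, rfl⟩
  rw [← Submodule.topologicalClosure_coe]
  -- The closure is a linear subspace, so it is enough to treat monomials in the fields.
  have hA' : A ∈ Submodule.span ℂ (Submonoid.closure (Set.range Q.Φ) : Set (Module.End ℂ Q.D)) := by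
    rw [← Algebra.adjoin_eq_span]
    exact hA
  clear hA
  induction hA' using Submodule.span_induction with
  | mem A hA =>
    obtain ⟨l, hl, rfl⟩ := Submonoid.exists_list_of_mem_closure hA
    obtain ⟨g, hg⟩ := E.exists_list_prod_eq hι l hl
    have := prod_apply_mem_closure hι hΩ g [] (by simp)
    rw [hg] at this
    exact this
  | zero => exact Submodule.zero_mem _
  | add A B _ _ hA hB => exact Submodule.add_mem _ hA hB
  | smul c A _ hA => exact Submodule.smul_mem _ c hA

end TemperedAnalytic

end TemperedQFT

end

theorem mainTheorem8 {d n : ℕ} {M : Type*} [TopologicalSpace M]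
    [ChartedSpace (TemperedQFT.Euc d) M] [IsManifold (𝓡 d) ω M]
    {H : Type*} [NormedAddCommGroup H] [InnerProductSpace ℂ H] [CompleteSpace H]
    (S : TemperedQFT.Spacetime d M) (Q : TemperedQFT.QuantumField d M H)
    (ι : M → TemperedQFT.Euc n) (hι : TemperedQFT.IsProperAnalyticEmbedding (d := d) ι)
    (E : TemperedQFT.TemperedExtension Q ι)
    (Ω : Q.D) (hΩ : TemperedQFT.IsTemperedAnalytic S E Ω) :
    (∀ g : List (TemperedQFT.SchwartzOn ι),
      (∀ u ∈ g, u ∈ TemperedQFT.analyticSchwartz ι) →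
        TemperedQFT.IsTemperedAnalytic S E (E.prod g Ω)) ∧
    (Q.IsCyclic Ω →
      Dense {v : H | ∃ φ : Q.D, TemperedQFT.IsTemperedAnalytic S E φ ∧ v = φ}) := by
  exact ⟨hΩ.prod_apply, TemperedQFT.dense_isTemperedAnalytic hι hΩ⟩
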